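/- Let $a_0<a_1<a_2<a_3$ be real numbers and let $$T=\{(x,y,z)\in\mathbb R^3:\ x,y,z>0,\ x^2+y^2+z^2>1\}.$$ For $(x,y,z)\in T$ the 5-cyclide coordinates $s_1,s_2,s_3$ of $(x,y,z)$ are defined as follows: $s_i$ ($i=1,2,3$) is the unique solution $s$ in the interval $(a_{i-1},a_i)$ of $$\frac{(x^2+y^2+z^2-1)^2}{s-a_0}+\frac{4x^2}{s-a_1}+\frac{4y^2}{s-a_2}+\frac{4z^2}{s-a_3}=0 .$$ Let $\lambda_1,\lambda_2\in\mathbb C$, and let $w_1:(a_0,a_1)\to\mathbb C$, $w_2:(a_1,a_2)\to\mathbb C$, $w_3:(a_2,a_3)\to\mathbb C$ be (twice differentiable) solutions of the Fuchsian equation $$\prod_{j=0}^3(s-a_j)\left[w''+\frac12\sum_{j=0}^3\frac{1}{s-a_j}\,w'\right]+\left(\frac{3}{16}s^2+\lambda_1 s+\lambda_2\right)w=0$$ on their respective intervals. Then the function $$u(x,y,z)=(x^2+y^2+z^2+1)^{-1/2}\,w_1(s_1)\,w_2(s_2)\,w_3(s_3)$$ is harmonic on $T$, that is, it is twice continuously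 differentiable there and $u_{xx}+u_{yy}+u_{zz}=0$. -/

import Mathlib

namespace FiveCyclide

open Set

/-- The set `T` of all `(x, y, z)` in Euclidean `ℝ³` with `x, y, z > 0` and `x² + y² + z² > 1`. -/
def T : Set (EuclideanSpace ℝ (Fin 3)) :=
  {p | 0 < p 0 ∧ 0 < p 1 ∧ 0 < p 2 ∧ 1 < p 0 ^ 2 + p 1 ^ 2 + p 2 ^ 2}

/-- The left-hand side of the equation of the confocal cyclides,
`(x² + y² + z² - 1)² / (s - a₀) + 4x² / (s - a₁) + 4y² / (s - a₂) + 4z² / (s - a₃)`.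
It is only used for `s` different from all `a j`. -/
noncomputable def cyclide (a : Fin 4 → ℝ) (p : EuclideanSpace ℝ (Fin 3)) (s : ℝ) : ℝ :=
  (p 0 ^ 2 + p 1 ^ 2 + p 2 ^ 2 - 1) ^ 2 / (s - a 0) + 4 * p 0 ^ 2 / (s - a 1)
    + 4 * p 1 ^ 2 / (s - a 2) + 4 * p 2 ^ 2 / (s - a 3)

/-- The 5-cyclide coordinate of `p` with values in the interval `(a i, a (i + 1))`, `i = 0, 1, 2`:
the solution `s` in that interval of `cyclide a p s = 0`. For `p ∈ T` there is exactly
one, see `existsUnique_coord`. -/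
noncomputable def coord (a : Fin 4 → ℝ) (i : Fin 3) (p : EuclideanSpace ℝ (Fin 3)) : ℝ :=
  Classical.epsilon fun s => s ∈ Ioo (a i.castSucc) (a i.succ) ∧ cyclide a p s = 0

/-- `w` is a solution on the set `I` (an open interval that avoids all `a j`) of the Fuchsian
equation with the finite singularities `a j` and van Vleck polynomial
`(3 / 16) s² + l₁ s + l₂`; `w'` and `w''` are the first and second derivative of `w` on `I`. -/
def IsFuchsSolution (a : Fin 4 → ℝ) (l₁ l₂ : ℂ) (I : Set ℝ) (w : ℝ → ℂ) : Prop :=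
  ∃ w' w'' : ℝ → ℂ, ∀ s ∈ I, HasDerivAt w (w' s) s ∧ HasDerivAt w' (w'' s) s ∧
    (∏ j : Fin 4, ((s : ℂ) - (a j : ℂ))) *
        (w'' s + (1 / 2) * (∑ j : Fin 4, 1 / ((s : ℂ) - (a j : ℂ))) * w' s)
      + ((3 / 16) * (s : ℂ) ^ 2 + l₁ * (s : ℂ) + l₂) * w s = 0

theorem existsUnique_coord (a : Fin 4 → ℝ) (ha : StrictMono a) (i : Fin 3)
    (p : EuclideanSpace ℝ (Fin 3)) (hp : p ∈ T) :
    ∃! s, s ∈ Ioo (a i.castSucc) (a i.succ) ∧ cyclide a p s = 0 := by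
  obtain ⟨hx, hy, hz, hr⟩ := hp
  have h01 : a 0 < a 1 := ha (by decide)
  have h12 : a 1 < a 2 := ha (by decide)
  have h23 : a 2 < a 3 := ha (by decide)
  have hc : ∀ c u v e : ℝ, 0 < c → u < v → 0 < (u - e) * (v - e) →
      c / (v - e) < c / (u - e) := by
    intro c u v e hc huv h
    have hu : u - e ≠ 0 := by rintro h0; simp [h0] at h
    have hv : v - e ≠ 0 := by rintro h0; simp [h0] at h
    have : c / (u - e) - c / (v - e) = c * (v - u) / ((u - e) * (v - e)) := by
      field_simp; ring
    have h2 : 0 < c * (v - u) / ((u - e) * (v - e)) :=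
      div_pos (mul_pos hc (sub_pos.2 huv)) h
    linarith
  have c0 : 0 < (p 0 ^ 2 + p 1 ^ 2 + p 2 ^ 2 - 1) ^ 2 := by
    have : 0 < p 0 ^ 2 + p 1 ^ 2 + p 2 ^ 2 - 1 := by linarith
    positivity
  have c1 : 0 < 4 * p 0 ^ 2 := by positivity
  have c2 : 0 < 4 * p 1 ^ 2 := by positivity
  have c3 : 0 < 4 * p 2 ^ 2 := by positivity
  -- points of the open interval lie on the same side of each `a j`
  have hside : ∀ j : Fin 4, (∀ s ∈ Ioo (a i.castSucc) (a i.succ), 0 < s - a j) ∨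
      (∀ s ∈ Ioo (a i.castSucc) (a i.succ), s - a j < 0) := by
    intro j
    rcases le_or_gt j i.castSucc with h | h
    · left; intro s hs
      have := ha.monotone h
      linarith [hs.1]
    · right; intro s hs
      have := ha.monotone (Fin.castSucc_lt_iff_succ_le.1 h)
      linarith [hs.2]
  have hanti : ∀ u ∈ Ioo (a i.castSucc) (a i.succ), ∀ v ∈ Ioo (a i.castSucc) (a i.succ),
      u < v → cyclide a p v < cyclide a p u := by
    intro u hu v hv huv
    have hs : ∀ j, 0 < (u - a j) * (v - a j) := by
      intro j
      rcases hside j with h | h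
      · exact mul_pos (h u hu) (h v hv)
      · exact mul_pos_of_neg_of_neg (h u hu) (h v hv)
    have e0 := hc _ u v _ c0 huv (hs 0)
    have e1 := hc _ u v _ c1 huv (hs 1)
    have e2 := hc _ u v _ c2 huv (hs 2)
    have e3 := hc _ u v _ c3 huv (hs 3)
    unfold cyclide
    linarith
  -- the polynomial obtained by clearing denominators
  let G : ℝ → ℝ := fun s =>
    (p 0 ^ 2 + p 1 ^ 2 + p 2 ^ 2 - 1) ^ 2 * ((s - a 1) * (s - a 2) * (s - a 3))
      + 4 * p 0 ^ 2 * ((s - a 0) * (s - a 2) * (s - a 3))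
      + 4 * p 1 ^ 2 * ((s - a 0) * (s - a 1) * (s - a 3))
      + 4 * p 2 ^ 2 * ((s - a 0) * (s - a 1) * (s - a 2))
  have hG : Continuous G := by fun_prop
  have g0 : G (a 0) < 0 := by
    have : 0 < (a 1 - a 0) * (a 2 - a 0) * (a 3 - a 0) :=
      mul_pos (mul_pos (by linarith) (by linarith)) (by linarith)
    have := mul_pos c0 this
    simp only [G]; linarith
  have g1 : 0 < G (a 1) := by
    have : 0 < (a 1 - a 0) * (a 2 - a 1) * (a 3 - a 1) :=
      mul_pos (mul_pos (by linarith) (by linarith)) (by linarith)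
    have := mul_pos c1 this
    simp only [G]; linarith
  have g2 : G (a 2) < 0 := by
    have : 0 < (a 2 - a 0) * (a 2 - a 1) * (a 3 - a 2) :=
      mul_pos (mul_pos (by linarith) (by linarith)) (by linarith)
    have := mul_pos c2 this
    simp only [G]; linarith
  have g3 : 0 < G (a 3) := by
    have : 0 < (a 3 - a 0) * (a 3 - a 1) * (a 3 - a 2) :=
      mul_pos (mul_pos (by linarith) (by linarith)) (by linarith)
    have := mul_pos c3 this
    simp only [G]; linarith
  have hroot : ∃ s ∈ Ioo (a i.castSucc) (a i.succ), G s = 0 := by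
    fin_cases i
    · exact intermediate_value_Ioo h01.le hG.continuousOn ⟨g0, g1⟩
    · exact intermediate_value_Ioo' h12.le hG.continuousOn ⟨g2, g1⟩
    · exact intermediate_value_Ioo h23.le hG.continuousOn ⟨g2, g3⟩
  obtain ⟨s, hs, hGs⟩ := hroot
  have hne : ∀ j, s - a j ≠ 0 := fun j =>
    (hside j).elim (fun h => (h s hs).ne') (fun h => (h s hs).ne)
  refine ⟨s, ⟨hs, ?_⟩, ?_⟩
  · have n0 := hne 0
    have n1 := hne 1
    have n2 := hne 2
    have n3 := hne 3
    have : cyclide a p s = G s / ((s - a 0) * (s - a 1) * (s - a 2) * (s - a 3)) := by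
      simp only [cyclide, G]
      field_simp
    rw [this, hGs, zero_div]
  · rintro t ⟨ht, ht0⟩
    have hs0 : cyclide a p s = 0 := by
      have n0 := hne 0
      have n1 := hne 1
      have n2 := hne 2
      have n3 := hne 3
      have : cyclide a p s = G s / ((s - a 0) * (s - a 1) * (s - a 2) * (s - a 3)) := by
        simp only [cyclide, G]
        field_simp
      rw [this, hGs, zero_div]
    rcases lt_trichotomy t s with h | h | h
    · have := hanti t ht s hs h; linarith
    · exact h
    · have := hanti s hs t ht h; linarith

theorem coord_spec (a : Fin 4 → ℝ) (ha : StrictMono a) (i : Fin 3)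
    (p : EuclideanSpace ℝ (Fin 3)) (hp : p ∈ T) :
    coord a i p ∈ Ioo (a i.castSucc) (a i.succ) ∧ cyclide a p (coord a i p) = 0 :=
  Classical.epsilon_spec (existsUnique_coord a ha i p hp).exists

end FiveCyclide

/-! Put R = x² + y² + z² + 1, ρ = R^(-1/2), P(s) = ∏ (s - aⱼ), let F(s) be the cyclide expression,
Nᵢ = -F'(sᵢ) (`negSlope`) and V(s) = (3/16) s² + λ₁ s + λ₂. Implicit differentiation of F = 0 shows
that the gradients of the sᵢ are mutually orthogonal (`sum_coordDeriv_mul`), that |∇sᵢ|² = 16/Nᵢ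
(`sum_coordDeriv_sq`), and that Δsᵢ - (2/R) p·∇sᵢ = (16/Nᵢ) · ½ ∑ 1/(sᵢ - aⱼ) (`sum_coordDeriv₂`).
Since ∇ρ = -(ρ/R) p, the cross term 2∇ρ·∇sᵢ absorbs exactly the radial part of ρ Δsᵢ. So the
derivatives of wᵢ enter Δu only through (16ρ/Nᵢ)(wᵢ'' + ½ ∑ 1/(sᵢ - aⱼ) wᵢ'), which by the Fuchsian
equation is -(16ρ/Nᵢ) V(sᵢ)/P(sᵢ) wᵢ.

It remains to sum these potentials. The sᵢ are the three roots of the cubic P·F, whose leading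
coefficient is R², so Nᵢ P(sᵢ) = -R² ∏ₖ (sᵢ - sₖ) over k ≠ i (`negSlope_mul_prod`). Hence ∑ (16/Nᵢ)
V(sᵢ)/P(sᵢ) is a second divided difference of V: it sees only the leading coefficient 3/16 and
equals -3/R² (`lagrange_identity`). This cancels Δρ = -3ρ/R².

The Laplacian is computed as a sum of second derivatives along coordinate lines, which reduces the
calculus to one real variable (`HasTwoJetAt`). -/

namespace FiveCyclide

open Set Filter
open scoped Topology

/-! ### Calculus of second-order jets in one real variable -/

/-- `f` is differentiable near `t`, its derivative is differentiable at `t`, and `f₁`, `f₂` are the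
first and second derivative of `f` at `t`. -/
def HasTwoJetAt {F : Type*} [NormedAddCommGroup F] [NormedSpace ℝ F]
    (f : ℝ → F) (f₁ f₂ : F) (t : ℝ) : Prop :=
  ∃ g : ℝ → F, (∀ᶠ x in 𝓝 t, HasDerivAt f (g x) x) ∧ g t = f₁ ∧ HasDerivAt g f₂ t

namespace HasTwoJetAt

variable {F : Type*} [NormedAddCommGroup F] [NormedSpace ℝ F] {f g : ℝ → F} {f₁ f₂ g₁ g₂ : F} {t : ℝ}

theorem deriv_eq (h : HasTwoJetAt f f₁ f₂ t) : deriv f t = f₁ := by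
  obtain ⟨d, hd, rfl, -⟩ := h
  exact hd.self_of_nhds.deriv

theorem deriv_deriv_eq (h : HasTwoJetAt f f₁ f₂ t) : deriv (deriv f) t = f₂ := by
  obtain ⟨d, hd, -, h2⟩ := h
  have : deriv f =ᶠ[𝓝 t] d := hd.mono fun x hx => hx.deriv
  rw [this.deriv_eq, h2.deriv]

theorem congr_values (h : HasTwoJetAt f f₁ f₂ t) (h₁ : f₁ = g₁) (h₂ : f₂ = g₂) :
    HasTwoJetAt f g₁ g₂ t := h₁ ▸ h₂ ▸ h

theorem const (c : F) (t : ℝ) : HasTwoJetAt (fun _ => c) 0 0 t :=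
  ⟨fun _ => 0, .of_forall fun _ => hasDerivAt_const _ _, rfl, hasDerivAt_const _ _⟩

theorem add (hf : HasTwoJetAt f f₁ f₂ t) (hg : HasTwoJetAt g g₁ g₂ t) :
    HasTwoJetAt (fun x => f x + g x) (f₁ + g₁) (f₂ + g₂) t := by
  obtain ⟨d, hd, rfl, h2⟩ := hf
  obtain ⟨e, he, rfl, k2⟩ := hg
  exact ⟨fun x => d x + e x, (hd.and he).mono fun x hx => hx.1.add hx.2, rfl, h2.add k2⟩

theorem mul {A : Type*} [NormedRing A] [NormedAlgebra ℝ A] {f g : ℝ → A} {f₁ f₂ g₁ g₂ : A}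
    (hf : HasTwoJetAt f f₁ f₂ t) (hg : HasTwoJetAt g g₁ g₂ t) :
    HasTwoJetAt (fun x => f x * g x) (f₁ * g t + f t * g₁)
      (f₂ * g t + 2 * (f₁ * g₁) + f t * g₂) t := by
  obtain ⟨d, hd, rfl, h2⟩ := hf
  obtain ⟨e, he, rfl, k2⟩ := hg
  refine ⟨fun x => d x * g x + f x * e x, (hd.and he).mono fun x hx => hx.1.mul hx.2, rfl, ?_⟩
  refine ((h2.mul he.self_of_nhds).add (hd.self_of_nhds.mul k2)).congr_deriv ?_
  rw [two_mul]; abel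

theorem comp {w : ℝ → F} {w₁ w₂ : F} {s : ℝ → ℝ} {y s₁ s₂ : ℝ}
    (hw : HasTwoJetAt w w₁ w₂ y) (hs : HasTwoJetAt s s₁ s₂ t) (hy : s t = y) :
    HasTwoJetAt (fun x => w (s x)) (s₁ • w₁) ((s₁ ^ 2) • w₂ + s₂ • w₁) t := by
  subst hy
  obtain ⟨d, hd, rfl, h2⟩ := hw
  obtain ⟨e, he, rfl, k2⟩ := hs
  refine ⟨fun x => e x • d (s x), ?_, rfl, ?_⟩
  · filter_upwards [he.self_of_nhds.continuousAt.eventually hd, he] with x h1 h2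
    exact h1.scomp x h2
  · refine (k2.smul (h2.scomp t he.self_of_nhds)).congr_deriv ?_
    rw [smul_smul, sq]
    rfl

theorem ofReal {s : ℝ → ℝ} {s₁ s₂ : ℝ} (hs : HasTwoJetAt s s₁ s₂ t) :
    HasTwoJetAt (fun x => (s x : ℂ)) (s₁ : ℂ) (s₂ : ℂ) t := by
  obtain ⟨e, he, rfl, k2⟩ := hs
  exact ⟨fun x => (e x : ℂ), he.mono fun x hx => hx.ofReal_comp, rfl, k2.ofReal_comp⟩

/-- Each summand of the cyclide equation has this shape along a line, with numerator and s both
varying; this is the input for implicit differentiation. -/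
theorem div_sub_const {s c : ℝ → ℝ} {s₁ s₂ c₁ c₂ b : ℝ} (hc : HasTwoJetAt c c₁ c₂ t)
    (hs : HasTwoJetAt s s₁ s₂ t) (hb : s t - b ≠ 0) :
    HasTwoJetAt (fun x => c x / (s x - b))
      (c₁ / (s t - b) - s₁ * (c t / (s t - b) ^ 2))
      (c₂ / (s t - b) - 2 * (s₁ * (c₁ / (s t - b) ^ 2)) + s₁ ^ 2 * (2 * c t / (s t - b) ^ 3)
        - s₂ * (c t / (s t - b) ^ 2)) t := by
  have hi : HasTwoJetAt (fun y : ℝ => (y - b)⁻¹) (-1 / (s t - b) ^ 2) (2 / (s t - b) ^ 3)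
      (s t) := by
    refine ⟨fun y => -1 / (y - b) ^ 2, ?_, rfl, ?_⟩
    · have : ∀ᶠ y in 𝓝 (s t), y - b ≠ 0 :=
        (continuousAt_id.sub continuousAt_const).eventually_ne hb
      filter_upwards [this] with y hy
      exact ((hasDerivAt_id y).sub_const b).inv hy
    · refine ((hasDerivAt_const (s t) (-1 : ℝ)).div (((hasDerivAt_id (s t)).sub_const b).pow 2)
        (pow_ne_zero 2 hb)).congr_deriv ?_
      simp only [id, Pi.pow_apply]
      field_simp
      ring
  have h := hc.mul (hi.comp hs rfl)
  simp only [← div_eq_mul_inv, smul_eq_mul] at h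
  refine h.congr_values ?_ ?_ <;> field_simp <;> ring

end HasTwoJetAt

/-! ### Restriction to lines -/

section Line

variable {E F : Type*} [NormedAddCommGroup E] [NormedSpace ℝ E] [NormedAddCommGroup F]
  [NormedSpace ℝ F]

theorem hasDerivAt_line (p v : E) (t : ℝ) : HasDerivAt (fun t : ℝ => p + t • v) v t := by
  simpa using ((hasDerivAt_id t).smul_const v).const_add p

/-- The bridge between the iterated Fréchet derivative, in which the Laplacian is expressed, and
one-variable jets. -/
theorem hasTwoJetAt_line_of_contDiffAt {f : E → F} {p : E} (hf : ContDiffAt ℝ 2 f p) (v : E) :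
    HasTwoJetAt (fun t : ℝ => f (p + t • v)) (fderiv ℝ f p v) (iteratedFDeriv ℝ 2 f p ![v, v])
      0 := by
  have hp : p + (0 : ℝ) • v = p := by simp
  have hc : ContinuousAt (fun t : ℝ => p + t • v) 0 := (hasDerivAt_line p v 0).continuousAt
  refine ⟨fun t => fderiv ℝ f (p + t • v) v, ?_, by simp, ?_⟩
  · have h1 : ∀ᶠ q in 𝓝 (p + (0 : ℝ) • v), ContDiffAt ℝ 2 f q := by
      rw [hp]
      exact hf.eventually (by decide)
    filter_upwards [hc.eventually h1] with t ht
    have h := (ht.differentiableAt (by simp)).hasFDerivAt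
    exact h.comp_hasDerivAt t (hasDerivAt_line p v t)
  · rw [iteratedFDeriv_two_apply]
    have h2 : HasFDerivAt (fderiv ℝ f) (fderiv ℝ (fderiv ℝ f) p) (p + (0 : ℝ) • v) := by
      rw [hp]
      exact ((hf.fderiv_right (m := 1) (by norm_num)).differentiableAt (by simp)).hasFDerivAt
    have h3 : HasDerivAt (fun t : ℝ => fderiv ℝ f (p + t • v)) (fderiv ℝ (fderiv ℝ f) p v) 0 :=
      h2.comp_hasDerivAt (0 : ℝ) (hasDerivAt_line p v 0)
    exact ((ContinuousLinearMap.apply ℝ F v).hasFDerivAt.comp_hasDerivAt (0 : ℝ) h3)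

end Line

/-! ### Regularity of the coordinates and of the Fuchsian solutions -/

theorem isOpen_T : IsOpen T := by
  unfold T
  simp only [ofPred_and]
  refine IsOpen.inter ?_ (IsOpen.inter ?_ (IsOpen.inter ?_ ?_)) <;>
  exact isOpen_lt (by fun_prop) (by fun_prop)

theorem sub_ne_zero_of_mem_Ioo {a : Fin 4 → ℝ} (ha : StrictMono a) {i : Fin 3} {s : ℝ}
    (hs : s ∈ Ioo (a i.castSucc) (a i.succ)) (j : Fin 4) : s - a j ≠ 0 := by
  rcases le_or_gt j i.castSucc with h | h
  · have := ha.monotone h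
    exact (by linarith [hs.1] : 0 < s - a j).ne'
  · have := ha.monotone (Fin.castSucc_lt_iff_succ_le.1 h)
    exact (by linarith [hs.2] : s - a j < 0).ne

/-- The negative of the `s`-derivative of `cyclide a p s`. -/
noncomputable def negSlope (a : Fin 4 → ℝ) (p : EuclideanSpace ℝ (Fin 3)) (s : ℝ) : ℝ :=
  (p 0 ^ 2 + p 1 ^ 2 + p 2 ^ 2 - 1) ^ 2 / (s - a 0) ^ 2 + 4 * p 0 ^ 2 / (s - a 1) ^ 2
    + 4 * p 1 ^ 2 / (s - a 2) ^ 2 + 4 * p 2 ^ 2 / (s - a 3) ^ 2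

theorem negSlope_pos {a : Fin 4 → ℝ} {p : EuclideanSpace ℝ (Fin 3)} (hp : p ∈ T) {s : ℝ}
    (hs : ∀ j, s - a j ≠ 0) : 0 < negSlope a p s := by
  obtain ⟨hx, -, -, -⟩ := hp
  have := hs 1
  unfold negSlope
  positivity

theorem hasDerivAt_cyclide {a : Fin 4 → ℝ} (p : EuclideanSpace ℝ (Fin 3)) {s : ℝ}
    (hs : ∀ j, s - a j ≠ 0) : HasDerivAt (cyclide a p) (-negSlope a p s) s := by
  have h : ∀ c b : ℝ, s - b ≠ 0 → HasDerivAt (fun s => c / (s - b)) (-(c / (s - b) ^ 2)) s := by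
    intro c b hb
    refine ((hasDerivAt_const s c).div ((hasDerivAt_id s).sub_const b) hb).congr_deriv ?_
    simp [neg_div]
  refine ((((h ((p 0 ^ 2 + p 1 ^ 2 + p 2 ^ 2 - 1) ^ 2) _ (hs 0)).add
    (h (4 * p 0 ^ 2) _ (hs 1))).add (h (4 * p 1 ^ 2) _ (hs 2))).add
    (h (4 * p 2 ^ 2) _ (hs 3))).congr_deriv ?_
  unfold negSlope
  ring

/-- Implicit function theorem: F is strictly decreasing in s at the root, with slope -`negSlope`. -/
theorem contDiffAt_coord {a : Fin 4 → ℝ} (ha : StrictMono a) (i : Fin 3)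
    {p : EuclideanSpace ℝ (Fin 3)} (hp : p ∈ T) : ContDiffAt ℝ 2 (coord a i) p := by
  obtain ⟨hmem, hzero⟩ := coord_spec a ha i p hp
  have hne := sub_ne_zero_of_mem_Ioo ha hmem
  set s := coord a i p with hs
  let f : EuclideanSpace ℝ (Fin 3) × ℝ → ℝ := fun u => cyclide a u.1 u.2
  have hf : ContDiffAt ℝ 2 f (p, s) := by
    have h0 := hne 0
    have h1 := hne 1
    have h2 := hne 2
    have h3 := hne 3
    simp only [f, cyclide]
    refine ContDiffAt.add (ContDiffAt.add (ContDiffAt.add ?_ ?_) ?_) ?_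
    all_goals
      refine ContDiffAt.div (by fun_prop) (by fun_prop) ?_
      assumption
  have hinv : (fderiv ℝ f (p, s) ∘L .inr ℝ (EuclideanSpace ℝ (Fin 3)) ℝ).IsInvertible := by
    have hd : HasDerivAt (fun y => f (p, y)) (fderiv ℝ f (p, s) (0, 1)) s :=
      (hf.differentiableAt (by simp)).hasFDerivAt.comp_hasDerivAt s
        ((hasDerivAt_const s p).prodMk (hasDerivAt_id s))
    have hd' : fderiv ℝ f (p, s) (0, 1) = -negSlope a p s :=
      hd.unique (hasDerivAt_cyclide p hne)
    have hn : -negSlope a p s ≠ 0 := neg_ne_zero.2 (negSlope_pos hp hne).ne'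
    refine ⟨ContinuousLinearEquiv.unitsEquivAut ℝ (Units.mk0 _ hn), ?_⟩
    ext
    simp [hd']
  -- Near p the implicit function still takes values in the open interval, and the root there is
  -- unique, so it coincides with the coordinate.
  have key : coord a i =ᶠ[𝓝 p] hf.implicitFunction (by simp) hinv := by
    have hψ := hf.contDiffAt_implicitFunction (by simp) hinv
    have hψ0 : hf.implicitFunction (by simp) hinv p = s :=
      hf.implicitFunction_apply_self (by simp) hinv
    have hI : ∀ᶠ q in 𝓝 p, hf.implicitFunction (by simp) hinv q ∈
        Ioo (a i.castSucc) (a i.succ) :=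
      hψ.continuousAt.eventually (isOpen_Ioo.mem_nhds (by rw [hψ0]; exact hmem))
    filter_upwards [hI, isOpen_T.mem_nhds hp,
      hf.eventually_apply_implicitFunction (by simp) hinv] with q h1 h2 h3
    refine (existsUnique_coord a ha i q h2).unique (coord_spec a ha i q h2) ⟨h1, ?_⟩
    exact h3.trans hzero
  exact (hf.contDiffAt_implicitFunction (by simp) hinv).congr_of_eventuallyEq key

theorem prod_sub_ne_zero {a : Fin 4 → ℝ} {s : ℝ} (hs : ∀ j, s - a j ≠ 0) :
    ∏ j : Fin 4, ((s : ℂ) - (a j : ℂ)) ≠ 0 :=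
  Finset.prod_ne_zero_iff.2 fun j _ => by exact_mod_cast hs j

/-- Only the existence of w'' is assumed; its continuity comes from solving the equation for w'', as
P has no zero on I. -/
theorem IsFuchsSolution.contDiffAt {a : Fin 4 → ℝ} {l₁ l₂ : ℂ} {I : Set ℝ} (hI : IsOpen I)
    (hne : ∀ s ∈ I, ∀ j, s - a j ≠ 0) {w : ℝ → ℂ} (hw : IsFuchsSolution a l₁ l₂ I w) {s : ℝ}
    (hs : s ∈ I) : ContDiffAt ℝ 2 w s := by
  obtain ⟨w', w'', h⟩ := hw
  have hc : ∀ x ∈ I, ContinuousAt w'' x := by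
    intro x hx
    have he : w'' =ᶠ[𝓝 x] fun s => -((3 / 16) * (s : ℂ) ^ 2 + l₁ * (s : ℂ) + l₂) * w s /
        (∏ j : Fin 4, ((s : ℂ) - (a j : ℂ))) -
        (1 / 2) * (∑ j : Fin 4, 1 / ((s : ℂ) - (a j : ℂ))) * w' s := by
      filter_upwards [hI.mem_nhds hx] with y hy
      have hP := prod_sub_ne_zero (hne y hy)
      have := (h y hy).2.2
      rw [eq_sub_iff_add_eq, eq_div_iff hP]
      linear_combination this
    refine ContinuousAt.congr ?_ he.symm
    have c1 := (h x hx).1.continuousAt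
    have c2 := (h x hx).2.1.continuousAt
    refine ContinuousAt.sub (ContinuousAt.div (by fun_prop) (by fun_prop)
      (prod_sub_ne_zero (hne x hx))) (ContinuousAt.mul (ContinuousAt.mul (by fun_prop) ?_) c2)
    refine tendsto_finsetSum _ fun j _ => ?_
    refine ContinuousAt.div (by fun_prop) (by fun_prop) ?_
    exact_mod_cast hne x hx j
  have e1 : EqOn (deriv w) w' I := fun x hx => (h x hx).1.deriv
  have e2 : EqOn (deriv (deriv w)) w'' I := fun x hx => by
    rw [(e1.eventuallyEq_of_mem (hI.mem_nhds hx)).deriv_eq, (h x hx).2.1.deriv]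
  have : ContDiffOn ℝ (1 + 1) w I := by
    rw [contDiffOn_succ_iff_deriv_of_isOpen hI]
    refine ⟨fun x hx => (h x hx).1.differentiableAt.differentiableWithinAt, by simp, ?_⟩
    rw [show (1 : WithTop ℕ∞) = 0 + 1 from (zero_add 1).symm,
      contDiffOn_succ_iff_deriv_of_isOpen hI]
    refine ⟨fun x hx => ((h x hx).2.1.differentiableAt.congr_of_eventuallyEq
      (e1.eventuallyEq_of_mem (hI.mem_nhds hx))).differentiableWithinAt, by simp, ?_⟩
    rw [contDiffOn_zero]
    exact ContinuousOn.congr (fun x hx => (hc x hx).continuousWithinAt) e2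
  rw [one_add_one_eq_two] at this
  exact this.contDiffAt (hI.mem_nhds hs)

theorem IsFuchsSolution.exists_hasTwoJetAt {a : Fin 4 → ℝ} {l₁ l₂ : ℂ} {I : Set ℝ}
    (hI : IsOpen I) {w : ℝ → ℂ} (hw : IsFuchsSolution a l₁ l₂ I w) {s : ℝ} (hs : s ∈ I) :
    ∃ w₁ w₂ : ℂ, HasTwoJetAt w w₁ w₂ s ∧
      (∏ j : Fin 4, ((s : ℂ) - (a j : ℂ))) *
          (w₂ + (1 / 2) * (∑ j : Fin 4, 1 / ((s : ℂ) - (a j : ℂ))) * w₁)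
        + ((3 / 16) * (s : ℂ) ^ 2 + l₁ * (s : ℂ) + l₂) * w s = 0 := by
  obtain ⟨w', w'', h⟩ := hw
  refine ⟨w' s, w'' s, ⟨w', ?_, rfl, (h s hs).2.1⟩, (h s hs).2.2⟩
  filter_upwards [hI.mem_nhds hs] with x hx using (h x hx).1

/-! ### Implicit differentiation of the cyclide equation -/

theorem hasTwoJetAt_line_coordinate (p e : EuclideanSpace ℝ (Fin 3)) (j : Fin 3) (t : ℝ) :
    HasTwoJetAt (fun t : ℝ => (p + t • e) j) (e j) 0 t := by
  refine ⟨fun _ => e j, .of_forall fun x => ?_, rfl, hasDerivAt_const _ _⟩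
  simpa using ((hasDerivAt_id x).mul_const (e j)).const_add (p j)

theorem hasTwoJetAt_line_coordinate_sq (p e : EuclideanSpace ℝ (Fin 3)) (j : Fin 3) :
    HasTwoJetAt (fun t : ℝ => (p + t • e) j ^ 2) (2 * (p j * e j)) (2 * e j ^ 2) 0 := by
  have h := (hasTwoJetAt_line_coordinate p e j 0).mul (hasTwoJetAt_line_coordinate p e j 0)
  simp only [← sq] at h
  exact h.congr_values (by simp; ring) (by simp)

theorem hasTwoJetAt_line_normSq_add (p e : EuclideanSpace ℝ (Fin 3)) (c : ℝ) :
    HasTwoJetAt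
      (fun t : ℝ => (p + t • e) 0 ^ 2 + (p + t • e) 1 ^ 2 + (p + t • e) 2 ^ 2 + c)
      (2 * (p 0 * e 0 + p 1 * e 1 + p 2 * e 2)) (2 * (e 0 ^ 2 + e 1 ^ 2 + e 2 ^ 2)) 0 :=
  ((((hasTwoJetAt_line_coordinate_sq p e 0).add (hasTwoJetAt_line_coordinate_sq p e 1)).add
    (hasTwoJetAt_line_coordinate_sq p e 2)).add (HasTwoJetAt.const c 0)).congr_values
      (by ring) (by ring)

/-- Obtained by differentiating F(p + te, s(p + te)) = 0 once and twice at t = 0 and isolating the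
terms that contain the first, respectively second, derivative of s. -/
theorem coord_line_derivatives {a : Fin 4 → ℝ} (ha : StrictMono a) (i : Fin 3)
    {p : EuclideanSpace ℝ (Fin 3)} (hp : p ∈ T) (e : EuclideanSpace ℝ (Fin 3))
    {s Q Q₁ Q₂ g h : ℝ} (hs : s = coord a i p) (hQ : Q = p 0 ^ 2 + p 1 ^ 2 + p 2 ^ 2 - 1)
    (hQ₁ : Q₁ = 2 * (p 0 * e 0 + p 1 * e 1 + p 2 * e 2))
    (hQ₂ : Q₂ = 2 * (e 0 ^ 2 + e 1 ^ 2 + e 2 ^ 2))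
    (hg : g = fderiv ℝ (coord a i) p e) (hh : h = iteratedFDeriv ℝ 2 (coord a i) p ![e, e]) :
    g * negSlope a p s = 2 * Q * Q₁ * (s - a 0)⁻¹ + 8 * (p 0 * e 0) * (s - a 1)⁻¹
        + 8 * (p 1 * e 1) * (s - a 2)⁻¹ + 8 * (p 2 * e 2) * (s - a 3)⁻¹ ∧
    h * negSlope a p s
      = (2 * Q₁ ^ 2 + 2 * Q * Q₂) * (s - a 0)⁻¹ + 8 * e 0 ^ 2 * (s - a 1)⁻¹
        + 8 * e 1 ^ 2 * (s - a 2)⁻¹ + 8 * e 2 ^ 2 * (s - a 3)⁻¹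
        - 2 * g * (2 * Q * Q₁ * (s - a 0)⁻¹ ^ 2 + 8 * (p 0 * e 0) * (s - a 1)⁻¹ ^ 2
          + 8 * (p 1 * e 1) * (s - a 2)⁻¹ ^ 2 + 8 * (p 2 * e 2) * (s - a 3)⁻¹ ^ 2)
        + 2 * g ^ 2 * (Q ^ 2 * (s - a 0)⁻¹ ^ 3 + 4 * p 0 ^ 2 * (s - a 1)⁻¹ ^ 3
          + 4 * p 1 ^ 2 * (s - a 2)⁻¹ ^ 3 + 4 * p 2 ^ 2 * (s - a 3)⁻¹ ^ 3) := by
  obtain ⟨hmem, -⟩ := coord_spec a ha i p hp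
  have hne := sub_ne_zero_of_mem_Ioo ha hmem
  have hp0 : p + (0 : ℝ) • e = p := by simp
  have hσ := hasTwoJetAt_line_of_contDiffAt (contDiffAt_coord ha i hp) e
  rw [← hg, ← hh] at hσ
  have hne' : ∀ j, (fun t : ℝ => coord a i (p + t • e)) 0 - a j ≠ 0 := by simpa using hne
  have hq := hasTwoJetAt_line_normSq_add p e (-1)
  rw [← hQ₁, ← hQ₂] at hq
  have hq2 := hq.mul hq
  have h4 := fun j => (HasTwoJetAt.const (4 : ℝ) 0).mul (hasTwoJetAt_line_coordinate_sq p e j)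
  have hF := (((hq2.div_sub_const hσ (hne' 0)).add ((h4 0).div_sub_const hσ (hne' 1))).add
    ((h4 1).div_sub_const hσ (hne' 2))).add ((h4 2).div_sub_const hσ (hne' 3))
  -- The equation holds for all t near 0 because T is open, so both derivatives of the left-hand
  -- side vanish.
  have hz : (fun t : ℝ => cyclide a (p + t • e) (coord a i (p + t • e))) =ᶠ[𝓝 0] fun _ => 0 := by
    have hc : ContinuousAt (fun t : ℝ => p + t • e) 0 := (hasDerivAt_line p e 0).continuousAt
    filter_upwards [hc.eventually (isOpen_T.mem_nhds (by simpa only [hp0] using hp))] with t ht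
    exact (coord_spec a ha i _ ht).2
  simp only [← sq, ← sub_eq_add_neg] at hF
  change HasTwoJetAt (fun t : ℝ => cyclide a (p + t • e) (coord a i (p + t • e))) _ _ 0 at hF
  have e1 := hz.deriv_eq.symm.trans hF.deriv_eq
  have e2 := hz.deriv.deriv_eq.symm.trans hF.deriv_deriv_eq
  simp only [hp0, ← hs, ← hQ, deriv_const, deriv_const', div_eq_mul_inv, ← inv_pow] at e1 e2
  simp only [negSlope, ← hQ, div_eq_mul_inv, ← inv_pow]
  exact ⟨by linear_combination e1, by linear_combination e2⟩

/-! ### Algebraic identities for gradients, Laplacians and cubics -/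

section Algebra

variable {x y z Q u₀ u₁ u₂ u₃ v₀ v₁ v₂ v₃ N M s t : ℝ}

/-- Here and below uⱼ stands for 1/(s - aⱼ). Expanding |N g|², the relation |p|² = Q + 1 and the
cyclide equation `h₀` eliminate all terms cubic in Q, leaving 16 N. -/
theorem cyclide_gradient_normSq {g₁ g₂ g₃ : ℝ} (hQ : Q = x ^ 2 + y ^ 2 + z ^ 2 - 1)
    (h₀ : Q ^ 2 * u₀ + 4 * x ^ 2 * u₁ + 4 * y ^ 2 * u₂ + 4 * z ^ 2 * u₃ = 0)
    (hN : N = Q ^ 2 * u₀ ^ 2 + 4 * x ^ 2 * u₁ ^ 2 + 4 * y ^ 2 * u₂ ^ 2 + 4 * z ^ 2 * u₃ ^ 2)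
    (hN0 : N ≠ 0) (hg₁ : g₁ * N = 4 * Q * x * u₀ + 8 * x * u₁)
    (hg₂ : g₂ * N = 4 * Q * y * u₀ + 8 * y * u₂) (hg₃ : g₃ * N = 4 * Q * z * u₀ + 8 * z * u₃) :
    (g₁ ^ 2 + g₂ ^ 2 + g₃ ^ 2) * N = 16 := by
  have key : (g₁ * N) ^ 2 + (g₂ * N) ^ 2 + (g₃ * N) ^ 2 = 16 * N := by
    rw [hg₁, hg₂, hg₃, hN]
    have : x ^ 2 + y ^ 2 + z ^ 2 = Q + 1 := by linear_combination -hQ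
    linear_combination 16 * Q * u₀ * h₀ + 16 * Q ^ 2 * u₀ ^ 2 * this
  apply mul_right_cancel₀ hN0
  linear_combination key

/-- The terms in M cancel because of the value of |g|². What is left of Δs is not symmetric in the
uⱼ: u₀ has coefficient 4(Q + 2) instead of 8. Subtracting 2 p·g, with R = Q + 2, restores the
symmetry. -/
theorem cyclide_laplacian {g₁ g₂ g₃ h₁ h₂ h₃ : ℝ} (hQ : Q = x ^ 2 + y ^ 2 + z ^ 2 - 1)
    (h₀ : Q ^ 2 * u₀ + 4 * x ^ 2 * u₁ + 4 * y ^ 2 * u₂ + 4 * z ^ 2 * u₃ = 0)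
    (hN : N = Q ^ 2 * u₀ ^ 2 + 4 * x ^ 2 * u₁ ^ 2 + 4 * y ^ 2 * u₂ ^ 2 + 4 * z ^ 2 * u₃ ^ 2)
    (hM : M = Q ^ 2 * u₀ ^ 3 + 4 * x ^ 2 * u₁ ^ 3 + 4 * y ^ 2 * u₂ ^ 3 + 4 * z ^ 2 * u₃ ^ 3)
    (hN0 : N ≠ 0) (hg₁ : g₁ * N = 4 * Q * x * u₀ + 8 * x * u₁)
    (hg₂ : g₂ * N = 4 * Q * y * u₀ + 8 * y * u₂) (hg₃ : g₃ * N = 4 * Q * z * u₀ + 8 * z * u₃)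
    (hh₁ : h₁ * N = (8 * x ^ 2 + 4 * Q) * u₀ + 8 * u₁
      - 2 * g₁ * (4 * Q * x * u₀ ^ 2 + 8 * x * u₁ ^ 2) + 2 * g₁ ^ 2 * M)
    (hh₂ : h₂ * N = (8 * y ^ 2 + 4 * Q) * u₀ + 8 * u₂
      - 2 * g₂ * (4 * Q * y * u₀ ^ 2 + 8 * y * u₂ ^ 2) + 2 * g₂ ^ 2 * M)
    (hh₃ : h₃ * N = (8 * z ^ 2 + 4 * Q) * u₀ + 8 * u₃
      - 2 * g₃ * (4 * Q * z * u₀ ^ 2 + 8 * z * u₃ ^ 2) + 2 * g₃ ^ 2 * M) :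
    ((h₁ + h₂ + h₃) * (Q + 2) - 2 * (x * g₁ + y * g₂ + z * g₃)) * N
      = 8 * (Q + 2) * (u₀ + u₁ + u₂ + u₃) := by
  have hr : x ^ 2 + y ^ 2 + z ^ 2 = Q + 1 := by linear_combination -hQ
  have hA := cyclide_gradient_normSq hQ h₀ hN hN0 hg₁ hg₂ hg₃
  -- The sum over the three directions of the mixed terms in `hh₁`, `hh₂`, `hh₃`.
  have hD : g₁ * (4 * Q * x * u₀ ^ 2 + 8 * x * u₁ ^ 2)
      + g₂ * (4 * Q * y * u₀ ^ 2 + 8 * y * u₂ ^ 2)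
      + g₃ * (4 * Q * z * u₀ ^ 2 + 8 * z * u₃ ^ 2)
      = (g₁ ^ 2 + g₂ ^ 2 + g₃ ^ 2) * M + 8 * Q * u₀ := by
    apply mul_right_cancel₀ hN0
    linear_combination (4 * Q * x * u₀ ^ 2 + 8 * x * u₁ ^ 2) * hg₁
      + (4 * Q * y * u₀ ^ 2 + 8 * y * u₂ ^ 2) * hg₂
      + (4 * Q * z * u₀ ^ 2 + 8 * z * u₃ ^ 2) * hg₃ - M * hA - 16 * hM - 8 * Q * u₀ * hN
      + 8 * Q * u₀ ^ 2 * h₀ + 16 * Q ^ 2 * u₀ ^ 3 * hr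
  have hH : (h₁ + h₂ + h₃) * N = 4 * (Q + 2) * u₀ + 8 * (u₁ + u₂ + u₃) := by
    linear_combination hh₁ + hh₂ + hh₃ - 2 * hD + 8 * u₀ * hr
  have hX : (x * g₁ + y * g₂ + z * g₃) * N = 2 * Q * (Q + 2) * u₀ := by
    linear_combination x * hg₁ + y * hg₂ + z * hg₃ + 2 * h₀ + 4 * Q * u₀ * hr
  linear_combination (Q + 2) * hH - 2 * hX

/-- Subtracting the cyclide equations at s and t and dividing by t - s gives `hc`, the relation
between the products uⱼvⱼ to which the inner product of the gradients reduces. -/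
theorem cyclide_gradient_orthogonal {g₁ g₂ g₃ k₁ k₂ k₃ L : ℝ}
    (hQ : Q = x ^ 2 + y ^ 2 + z ^ 2 - 1)
    (hu : Q ^ 2 * u₀ + 4 * x ^ 2 * u₁ + 4 * y ^ 2 * u₂ + 4 * z ^ 2 * u₃ = 0)
    (hv : Q ^ 2 * v₀ + 4 * x ^ 2 * v₁ + 4 * y ^ 2 * v₂ + 4 * z ^ 2 * v₃ = 0)
    (hst : s ≠ t) (e₀ : u₀ - v₀ = (t - s) * (u₀ * v₀)) (e₁ : u₁ - v₁ = (t - s) * (u₁ * v₁))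
    (e₂ : u₂ - v₂ = (t - s) * (u₂ * v₂)) (e₃ : u₃ - v₃ = (t - s) * (u₃ * v₃))
    (hN0 : N ≠ 0) (hg₁ : g₁ * N = 4 * Q * x * u₀ + 8 * x * u₁)
    (hg₂ : g₂ * N = 4 * Q * y * u₀ + 8 * y * u₂) (hg₃ : g₃ * N = 4 * Q * z * u₀ + 8 * z * u₃)
    (hL0 : L ≠ 0) (hk₁ : k₁ * L = 4 * Q * x * v₀ + 8 * x * v₁)
    (hk₂ : k₂ * L = 4 * Q * y * v₀ + 8 * y * v₂) (hk₃ : k₃ * L = 4 * Q * z * v₀ + 8 * z * v₃) :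
    g₁ * k₁ + g₂ * k₂ + g₃ * k₃ = 0 := by
  have hr : x ^ 2 + y ^ 2 + z ^ 2 = Q + 1 := by linear_combination -hQ
  have hc : Q ^ 2 * (u₀ * v₀) + 4 * x ^ 2 * (u₁ * v₁) + 4 * y ^ 2 * (u₂ * v₂)
      + 4 * z ^ 2 * (u₃ * v₃) = 0 := by
    apply mul_left_cancel₀ (sub_ne_zero.2 hst.symm)
    linear_combination hu - hv - Q ^ 2 * e₀ - 4 * x ^ 2 * e₁ - 4 * y ^ 2 * e₂ - 4 * z ^ 2 * e₃
  have key : (g₁ * N) * (k₁ * L) + (g₂ * N) * (k₂ * L) + (g₃ * N) * (k₃ * L) = 0 := by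
    rw [hg₁, hg₂, hg₃, hk₁, hk₂, hk₃]
    linear_combination 16 * hc + 8 * Q * u₀ * hv + 8 * Q * v₀ * hu + 16 * Q ^ 2 * u₀ * v₀ * hr
  apply mul_right_cancel₀ (mul_ne_zero hN0 hL0)
  linear_combination key

/-- The derivative of a cubic polynomial at one of three distinct roots. -/
theorem cubic_derivative_at_root {α β γ δ r₁ r₂ r₃ : ℝ} (h₁₂ : r₁ ≠ r₂) (h₁₃ : r₁ ≠ r₃)
    (h₂₃ : r₂ ≠ r₃) (h₁ : α * r₁ ^ 3 + β * r₁ ^ 2 + γ * r₁ + δ = 0)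
    (h₂ : α * r₂ ^ 3 + β * r₂ ^ 2 + γ * r₂ + δ = 0)
    (h₃ : α * r₃ ^ 3 + β * r₃ ^ 2 + γ * r₃ + δ = 0) :
    3 * α * r₁ ^ 2 + 2 * β * r₁ + γ = α * ((r₁ - r₂) * (r₁ - r₃)) := by
  -- First divided differences of the cubic vanish at pairs of roots; the second one, `d`, gives the
  -- sum of the roots.
  have d₁₂ : α * (r₁ ^ 2 + r₁ * r₂ + r₂ ^ 2) + β * (r₁ + r₂) + γ = 0 := by
    apply mul_left_cancel₀ (sub_ne_zero.2 h₁₂)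
    linear_combination h₁ - h₂
  have d₁₃ : α * (r₁ ^ 2 + r₁ * r₃ + r₃ ^ 2) + β * (r₁ + r₃) + γ = 0 := by
    apply mul_left_cancel₀ (sub_ne_zero.2 h₁₃)
    linear_combination h₁ - h₃
  have d : α * (r₁ + r₂ + r₃) + β = 0 := by
    apply mul_left_cancel₀ (sub_ne_zero.2 h₂₃)
    linear_combination d₁₂ - d₁₃
  linear_combination d₁₂ + (r₁ - r₂) * d

end Algebra

/-- Both sides are the negative of the derivative at s₁ of the cubic G = P·F. At a root of F this
derivative is P F' = -P N; on the other hand G has the roots s₁, s₂, s₃ and leading coefficient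
(|p|² - 1)² + 4|p|² = (|p|² + 1)². -/
theorem negSlope_mul_prod {a : Fin 4 → ℝ} {p : EuclideanSpace ℝ (Fin 3)} {s₁ s₂ s₃ : ℝ}
    (h₁₂ : s₁ ≠ s₂) (h₁₃ : s₁ ≠ s₃) (h₂₃ : s₂ ≠ s₃) (n₁ : ∀ j, s₁ - a j ≠ 0)
    (n₂ : ∀ j, s₂ - a j ≠ 0) (n₃ : ∀ j, s₃ - a j ≠ 0) (z₁ : cyclide a p s₁ = 0)
    (z₂ : cyclide a p s₂ = 0) (z₃ : cyclide a p s₃ = 0) :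
    negSlope a p s₁ * ∏ j, (s₁ - a j)
      = -((p 0 ^ 2 + p 1 ^ 2 + p 2 ^ 2 + 1) ^ 2 * ((s₁ - s₂) * (s₁ - s₃))) := by
  obtain ⟨c₀, h₀⟩ : ∃ c, c = (p 0 ^ 2 + p 1 ^ 2 + p 2 ^ 2 - 1) ^ 2 := ⟨_, rfl⟩
  obtain ⟨c₁, h₁⟩ : ∃ c, c = 4 * p 0 ^ 2 := ⟨_, rfl⟩
  obtain ⟨c₂, h₂⟩ : ∃ c, c = 4 * p 1 ^ 2 := ⟨_, rfl⟩
  obtain ⟨c₃, h₃⟩ : ∃ c, c = 4 * p 2 ^ 2 := ⟨_, rfl⟩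
  have hR : (p 0 ^ 2 + p 1 ^ 2 + p 2 ^ 2 + 1) ^ 2 = c₀ + c₁ + c₂ + c₃ := by
    rw [h₀, h₁, h₂, h₃]; ring
  have cubic : ∀ s, (∀ j, s - a j ≠ 0) → cyclide a p s = 0 →
      c₀ * ((s - a 1) * (s - a 2) * (s - a 3)) + c₁ * ((s - a 0) * (s - a 2) * (s - a 3))
      + c₂ * ((s - a 0) * (s - a 1) * (s - a 3))
      + c₃ * ((s - a 0) * (s - a 1) * (s - a 2)) = 0 := by
    intro s hs hz
    have m0 := hs 0
    have m1 := hs 1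
    have m2 := hs 2
    have m3 := hs 3
    rw [cyclide, ← h₀, ← h₁, ← h₂, ← h₃] at hz
    field_simp at hz
    linear_combination hz
  have hd := cubic_derivative_at_root (α := c₀ + c₁ + c₂ + c₃)
    (β := -(c₀ * (a 1 + a 2 + a 3) + c₁ * (a 0 + a 2 + a 3) + c₂ * (a 0 + a 1 + a 3)
      + c₃ * (a 0 + a 1 + a 2)))
    (γ := c₀ * (a 1 * a 2 + a 1 * a 3 + a 2 * a 3) + c₁ * (a 0 * a 2 + a 0 * a 3 + a 2 * a 3)
      + c₂ * (a 0 * a 1 + a 0 * a 3 + a 1 * a 3) + c₃ * (a 0 * a 1 + a 0 * a 2 + a 1 * a 2))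
    (δ := -(c₀ * (a 1 * a 2 * a 3) + c₁ * (a 0 * a 2 * a 3) + c₂ * (a 0 * a 1 * a 3)
      + c₃ * (a 0 * a 1 * a 2))) h₁₂ h₁₃ h₂₃
    (by linear_combination cubic s₁ n₁ z₁) (by linear_combination cubic s₂ n₂ z₂)
    (by linear_combination cubic s₃ n₃ z₃)
  have m0 := n₁ 0
  have m1 := n₁ 1
  have m2 := n₁ 2
  have m3 := n₁ 3
  rw [hR, ← hd]
  rw [cyclide, ← h₀, ← h₁, ← h₂, ← h₃] at z₁
  rw [negSlope, ← h₀, ← h₁, ← h₂, ← h₃, Fin.prod_univ_four]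
  -- The product rule N P = F P' - G', in which F vanishes at s₁.
  have hN : (c₀ / (s₁ - a 0) ^ 2 + c₁ / (s₁ - a 1) ^ 2 + c₂ / (s₁ - a 2) ^ 2
      + c₃ / (s₁ - a 3) ^ 2) * ((s₁ - a 0) * (s₁ - a 1) * (s₁ - a 2) * (s₁ - a 3))
      = (c₀ / (s₁ - a 0) + c₁ / (s₁ - a 1) + c₂ / (s₁ - a 2) + c₃ / (s₁ - a 3))
        * ((s₁ - a 1) * (s₁ - a 2) * (s₁ - a 3) + (s₁ - a 0) * (s₁ - a 2) * (s₁ - a 3)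
          + (s₁ - a 0) * (s₁ - a 1) * (s₁ - a 3) + (s₁ - a 0) * (s₁ - a 1) * (s₁ - a 2))
        - (c₀ * ((s₁ - a 1) * (s₁ - a 2) + (s₁ - a 1) * (s₁ - a 3) + (s₁ - a 2) * (s₁ - a 3))
          + c₁ * ((s₁ - a 0) * (s₁ - a 2) + (s₁ - a 0) * (s₁ - a 3) + (s₁ - a 2) * (s₁ - a 3))
          + c₂ * ((s₁ - a 0) * (s₁ - a 1) + (s₁ - a 0) * (s₁ - a 3) + (s₁ - a 1) * (s₁ - a 3))
          + c₃ * ((s₁ - a 0) * (s₁ - a 1) + (s₁ - a 0) * (s₁ - a 2)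
            + (s₁ - a 1) * (s₁ - a 2))) := by
    field_simp
    ring
  rw [hN, z₁]
  ring

theorem coord_lt_coord {a : Fin 4 → ℝ} (ha : StrictMono a) {p : EuclideanSpace ℝ (Fin 3)}
    (hp : p ∈ T) {i j : Fin 3} (hij : i < j) : coord a i p < coord a j p :=
  (coord_spec a ha i p hp).1.2.trans_le ((ha.monotone (Fin.succ_le_castSucc_iff.2 hij)).trans
    (coord_spec a ha j p hp).1.1.le)

/-! ### Partial derivatives of the coordinates -/

/-- The `k`-th vector of the standard basis of `ℝ³`. -/
noncomputable def stdVec (k : Fin 3) : EuclideanSpace ℝ (Fin 3) :=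
  EuclideanSpace.basisFun (Fin 3) ℝ k

/-- The first partial derivatives of the coordinate `coord a i` at `p`. -/
noncomputable def coordDeriv (a : Fin 4 → ℝ) (i : Fin 3) (p : EuclideanSpace ℝ (Fin 3))
    (k : Fin 3) : ℝ := fderiv ℝ (coord a i) p (stdVec k)

/-- The unmixed second partial derivatives of the coordinate `coord a i` at `p`. -/
noncomputable def coordDeriv₂ (a : Fin 4 → ℝ) (i : Fin 3) (p : EuclideanSpace ℝ (Fin 3))
    (k : Fin 3) : ℝ := iteratedFDeriv ℝ 2 (coord a i) p ![stdVec k, stdVec k]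

variable {a : Fin 4 → ℝ} {p : EuclideanSpace ℝ (Fin 3)}

theorem hasTwoJetAt_coord_line (ha : StrictMono a) (hp : p ∈ T) (i k : Fin 3) :
    HasTwoJetAt (fun t : ℝ => coord a i (p + t • stdVec k)) (coordDeriv a i p k)
      (coordDeriv₂ a i p k) 0 :=
  hasTwoJetAt_line_of_contDiffAt (contDiffAt_coord ha i hp) (stdVec k)

theorem cyclide_coord_eq_zero (ha : StrictMono a) (hp : p ∈ T) (i : Fin 3) :
    (p 0 ^ 2 + p 1 ^ 2 + p 2 ^ 2 - 1) ^ 2 * (coord a i p - a 0)⁻¹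
      + 4 * p 0 ^ 2 * (coord a i p - a 1)⁻¹ + 4 * p 1 ^ 2 * (coord a i p - a 2)⁻¹
      + 4 * p 2 ^ 2 * (coord a i p - a 3)⁻¹ = 0 := by
  simpa only [cyclide, div_eq_mul_inv] using (coord_spec a ha i p hp).2

theorem negSlope_eq (s : ℝ) :
    negSlope a p s = (p 0 ^ 2 + p 1 ^ 2 + p 2 ^ 2 - 1) ^ 2 * (s - a 0)⁻¹ ^ 2
      + 4 * p 0 ^ 2 * (s - a 1)⁻¹ ^ 2 + 4 * p 1 ^ 2 * (s - a 2)⁻¹ ^ 2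
      + 4 * p 2 ^ 2 * (s - a 3)⁻¹ ^ 2 := by
  simp only [negSlope, div_eq_mul_inv, inv_pow]

theorem coordDeriv_mul_negSlope (ha : StrictMono a) (hp : p ∈ T) (i : Fin 3) (k : Fin 3) :
    coordDeriv a i p k * negSlope a p (coord a i p)
      = 4 * (p 0 ^ 2 + p 1 ^ 2 + p 2 ^ 2 - 1) * p k * (coord a i p - a 0)⁻¹
        + 8 * p k * (coord a i p - a k.succ)⁻¹ := by
  have h := (coord_line_derivatives ha i hp (stdVec k) rfl rfl rfl rfl rfl rfl).1
  rw [coordDeriv, h]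
  fin_cases k <;> simp [stdVec, -mul_eq_mul_right_iff] <;> ring

theorem coordDeriv₂_mul_negSlope (ha : StrictMono a) (hp : p ∈ T) (i : Fin 3) (k : Fin 3) :
    coordDeriv₂ a i p k * negSlope a p (coord a i p)
      = (8 * p k ^ 2 + 4 * (p 0 ^ 2 + p 1 ^ 2 + p 2 ^ 2 - 1)) * (coord a i p - a 0)⁻¹
        + 8 * (coord a i p - a k.succ)⁻¹
        - 2 * coordDeriv a i p k
          * (4 * (p 0 ^ 2 + p 1 ^ 2 + p 2 ^ 2 - 1) * p k * (coord a i p - a 0)⁻¹ ^ 2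
            + 8 * p k * (coord a i p - a k.succ)⁻¹ ^ 2)
        + 2 * coordDeriv a i p k ^ 2
          * ((p 0 ^ 2 + p 1 ^ 2 + p 2 ^ 2 - 1) ^ 2 * (coord a i p - a 0)⁻¹ ^ 3
            + 4 * p 0 ^ 2 * (coord a i p - a 1)⁻¹ ^ 3 + 4 * p 1 ^ 2 * (coord a i p - a 2)⁻¹ ^ 3
            + 4 * p 2 ^ 2 * (coord a i p - a 3)⁻¹ ^ 3) := by
  have h := (coord_line_derivatives ha i hp (stdVec k) rfl rfl rfl rfl rfl rfl).2
  rw [coordDeriv₂, h, coordDeriv]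
  generalize fderiv ℝ (coord a i) p (stdVec k) = g
  fin_cases k <;> simp only [stdVec] <;> simp <;> ring

theorem negSlope_coord_pos (ha : StrictMono a) (hp : p ∈ T) (i : Fin 3) :
    0 < negSlope a p (coord a i p) :=
  negSlope_pos hp (sub_ne_zero_of_mem_Ioo ha (coord_spec a ha i p hp).1)

theorem sum_coordDeriv_sq (ha : StrictMono a) (hp : p ∈ T) (i : Fin 3) :
    coordDeriv a i p 0 ^ 2 + coordDeriv a i p 1 ^ 2 + coordDeriv a i p 2 ^ 2
      = 16 / negSlope a p (coord a i p) := by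
  rw [eq_div_iff (negSlope_coord_pos ha hp i).ne']
  exact cyclide_gradient_normSq rfl (cyclide_coord_eq_zero ha hp i) (negSlope_eq _)
    (negSlope_coord_pos ha hp i).ne' (coordDeriv_mul_negSlope ha hp i 0)
    (coordDeriv_mul_negSlope ha hp i 1) (coordDeriv_mul_negSlope ha hp i 2)

/-- The radial term is kept separate because the cross term with ∇ρ cancels it; the remainder
matches the first-order coefficient of the Fuchsian equation. -/
theorem sum_coordDeriv₂ (ha : StrictMono a) (hp : p ∈ T) (i : Fin 3) :
    coordDeriv₂ a i p 0 + coordDeriv₂ a i p 1 + coordDeriv₂ a i p 2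
      = 2 * (p 0 * coordDeriv a i p 0 + p 1 * coordDeriv a i p 1 + p 2 * coordDeriv a i p 2)
          / (p 0 ^ 2 + p 1 ^ 2 + p 2 ^ 2 + 1)
        + 16 / negSlope a p (coord a i p) * (1 / 2 * ∑ j, 1 / (coord a i p - a j)) := by
  have hN := (negSlope_coord_pos ha hp i).ne'
  have h := cyclide_laplacian rfl (cyclide_coord_eq_zero ha hp i) (negSlope_eq _) rfl hN
    (coordDeriv_mul_negSlope ha hp i 0) (coordDeriv_mul_negSlope ha hp i 1)
    (coordDeriv_mul_negSlope ha hp i 2) (coordDeriv₂_mul_negSlope ha hp i 0)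
    (coordDeriv₂_mul_negSlope ha hp i 1) (coordDeriv₂_mul_negSlope ha hp i 2)
  have hR : p 0 ^ 2 + p 1 ^ 2 + p 2 ^ 2 + 1 ≠ 0 := by positivity
  rw [Fin.sum_univ_four]
  simp only [one_div]
  generalize (coord a i p - a 0)⁻¹ + (coord a i p - a 1)⁻¹ + (coord a i p - a 2)⁻¹
    + (coord a i p - a 3)⁻¹ = S at h ⊢
  field_simp
  linear_combination 2 * h

theorem sum_coordDeriv_mul (ha : StrictMono a) (hp : p ∈ T) {i j : Fin 3} (hij : i < j) :
    coordDeriv a i p 0 * coordDeriv a j p 0 + coordDeriv a i p 1 * coordDeriv a j p 1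
      + coordDeriv a i p 2 * coordDeriv a j p 2 = 0 := by
  have hi := sub_ne_zero_of_mem_Ioo ha (coord_spec a ha i p hp).1
  have hj := sub_ne_zero_of_mem_Ioo ha (coord_spec a ha j p hp).1
  have e : ∀ k, (coord a i p - a k)⁻¹ - (coord a j p - a k)⁻¹
      = (coord a j p - coord a i p) * ((coord a i p - a k)⁻¹ * (coord a j p - a k)⁻¹) := by
    intro k
    have := hi k
    have := hj k
    field_simp
    ring
  exact cyclide_gradient_orthogonal rfl (cyclide_coord_eq_zero ha hp i)
    (cyclide_coord_eq_zero ha hp j) (coord_lt_coord ha hp hij).ne (e 0) (e 1) (e 2) (e 3)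
    (negSlope_coord_pos ha hp i).ne'
    (coordDeriv_mul_negSlope ha hp i 0) (coordDeriv_mul_negSlope ha hp i 1)
    (coordDeriv_mul_negSlope ha hp i 2) (negSlope_coord_pos ha hp j).ne'
    (coordDeriv_mul_negSlope ha hp j 0) (coordDeriv_mul_negSlope ha hp j 1)
    (coordDeriv_mul_negSlope ha hp j 2)

/-! ### Lagrange interpolation, the radial factor and the product rule -/

/-- The second divided difference of a quadratic polynomial is its leading coefficient, with the
nodal products `(sᵢ - sⱼ) * (sᵢ - sₖ)` given as `-(Nᵢ * Pᵢ) / R²`. -/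
theorem lagrange_identity {s₁ s₂ s₃ N₁ N₂ N₃ P₁ P₂ P₃ R : ℂ} (h₁₂ : s₁ ≠ s₂) (h₁₃ : s₁ ≠ s₃)
    (h₂₃ : s₂ ≠ s₃) (hR : R ≠ 0) (H₁ : N₁ * P₁ = -(R ^ 2 * ((s₁ - s₂) * (s₁ - s₃))))
    (H₂ : N₂ * P₂ = -(R ^ 2 * ((s₂ - s₁) * (s₂ - s₃))))
    (H₃ : N₃ * P₃ = -(R ^ 2 * ((s₃ - s₁) * (s₃ - s₂)))) (c l₁ l₂ : ℂ) :
    16 / N₁ * ((c * s₁ ^ 2 + l₁ * s₁ + l₂) / P₁) + 16 / N₂ * ((c * s₂ ^ 2 + l₁ * s₂ + l₂) / P₂)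
      + 16 / N₃ * ((c * s₃ ^ 2 + l₁ * s₃ + l₂) / P₃) = -(16 * c / R ^ 2) := by
  have d₁₂ := sub_ne_zero.2 h₁₂
  have d₁₃ := sub_ne_zero.2 h₁₃
  have d₂₃ := sub_ne_zero.2 h₂₃
  rw [div_mul_div_comm, div_mul_div_comm, div_mul_div_comm, H₁, H₂, H₃,
    ← neg_sub s₁ s₂, ← neg_sub s₁ s₃, ← neg_sub s₂ s₃]
  field_simp
  ring

theorem contDiffAt_radial (p : EuclideanSpace ℝ (Fin 3)) :
    ContDiffAt ℝ 2 (fun p : EuclideanSpace ℝ (Fin 3) =>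
      (p 0 ^ 2 + p 1 ^ 2 + p 2 ^ 2 + 1) ^ (-(1 / 2) : ℝ)) p :=
  ContDiffAt.rpow_const_of_ne (by fun_prop) (by positivity)

theorem hasTwoJetAt_radial_line (p : EuclideanSpace ℝ (Fin 3)) (k : Fin 3) {R ρ : ℝ}
    (hR : R = p 0 ^ 2 + p 1 ^ 2 + p 2 ^ 2 + 1) (hρ : ρ = R ^ (-(1 / 2) : ℝ)) :
    HasTwoJetAt (fun t : ℝ => ((p + t • stdVec k) 0 ^ 2 + (p + t • stdVec k) 1 ^ 2
      + (p + t • stdVec k) 2 ^ 2 + 1) ^ (-(1 / 2) : ℝ))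
      (-(p k * ρ / R)) (3 * p k ^ 2 * ρ / R ^ 2 - ρ / R) 0 := by
  have hR0 : R ≠ 0 := by rw [hR]; positivity
  have hpow : HasTwoJetAt (fun y : ℝ => y ^ (-(1 / 2) : ℝ)) (-(1 / 2) * (ρ / R))
      (3 / 4 * (ρ / R ^ 2)) R := by
    refine ⟨fun y => -(1 / 2) * y ^ (-(1 / 2) - 1 : ℝ), ?_, ?_, ?_⟩
    · filter_upwards [isOpen_ne.mem_nhds hR0] with y hy
      exact Real.hasDerivAt_rpow_const (Or.inl hy)
    · simp only [Real.rpow_sub_one hR0, hρ]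
    · refine ((Real.hasDerivAt_rpow_const (Or.inl hR0)).const_mul _).congr_deriv ?_
      rw [Real.rpow_sub_one hR0, Real.rpow_sub_one hR0, ← hρ]
      field_simp
      ring
  have hline := hasTwoJetAt_line_normSq_add p (stdVec k) 1
  refine (hpow.comp hline (by simp [hR])).congr_values ?_ ?_ <;> fin_cases k <;>
    simp [stdVec] <;> field_simp <;> ring

/-- The product `ρ w₁(s₁) w₂(s₂) w₃(s₃)` along a line, at second order. -/
theorem HasTwoJetAt.ofReal_mul_comp₃ {ρ s₁ s₂ s₃ : ℝ → ℝ} {w₁ w₂ w₃ : ℝ → ℂ}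
    {ρ' ρ'' s₁' s₁'' s₂' s₂'' s₃' s₃'' t : ℝ} {w₁' w₁'' w₂' w₂'' w₃' w₃'' : ℂ}
    (hρ : HasTwoJetAt ρ ρ' ρ'' t) (hs₁ : HasTwoJetAt s₁ s₁' s₁'' t)
    (hs₂ : HasTwoJetAt s₂ s₂' s₂'' t) (hs₃ : HasTwoJetAt s₃ s₃' s₃'' t)
    (hw₁ : HasTwoJetAt w₁ w₁' w₁'' (s₁ t)) (hw₂ : HasTwoJetAt w₂ w₂' w₂'' (s₂ t))
    (hw₃ : HasTwoJetAt w₃ w₃' w₃'' (s₃ t)) :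
    deriv (deriv fun x => (ρ x : ℂ) * w₁ (s₁ x) * w₂ (s₂ x) * w₃ (s₃ x)) t
      = ρ'' * (w₁ (s₁ t) * w₂ (s₂ t) * w₃ (s₃ t))
        + (ρ t * (s₁' ^ 2 * w₁'' + s₁'' * w₁') + 2 * ρ' * s₁' * w₁') * (w₂ (s₂ t) * w₃ (s₃ t))
        + (ρ t * (s₂' ^ 2 * w₂'' + s₂'' * w₂') + 2 * ρ' * s₂' * w₂') * (w₁ (s₁ t) * w₃ (s₃ t))
        + (ρ t * (s₃' ^ 2 * w₃'' + s₃'' * w₃') + 2 * ρ' * s₃' * w₃') * (w₁ (s₁ t) * w₂ (s₂ t))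
        + 2 * ρ t * (s₁' * s₂' * (w₁' * w₂' * w₃ (s₃ t)) + s₁' * s₃' * (w₁' * w₃' * w₂ (s₂ t))
          + s₂' * s₃' * (w₂' * w₃' * w₁ (s₁ t))) := by
  rw [(((hρ.ofReal.mul (hw₁.comp hs₁ rfl)).mul (hw₂.comp hs₂ rfl)).mul
    (hw₃.comp hs₃ rfl)).deriv_deriv_eq]
  simp only [Complex.real_smul, Complex.ofReal_pow]
  ring

end FiveCyclide

/-! ### Assembly of the Laplacian -/

theorem theorem4p1 (a : Fin 4 → ℝ) (ha : StrictMono a) (l₁ l₂ : ℂ) (w₁ w₂ w₃ : ℝ → ℂ)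
    (hw₁ : FiveCyclide.IsFuchsSolution a l₁ l₂ (Set.Ioo (a 0) (a 1)) w₁)
    (hw₂ : FiveCyclide.IsFuchsSolution a l₁ l₂ (Set.Ioo (a 1) (a 2)) w₂)
    (hw₃ : FiveCyclide.IsFuchsSolution a l₁ l₂ (Set.Ioo (a 2) (a 3)) w₃) :
    InnerProductSpace.HarmonicOnNhd
      (fun p : EuclideanSpace ℝ (Fin 3) =>
        (((p 0 ^ 2 + p 1 ^ 2 + p 2 ^ 2 + 1) ^ (-(1 / 2) : ℝ) : ℝ) : ℂ)
          * w₁ (FiveCyclide.coord a 0 p) * w₂ (FiveCyclide.coord a 1 p)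
          * w₃ (FiveCyclide.coord a 2 p))
      FiveCyclide.T := by
  open FiveCyclide in
  have hu : ∀ q ∈ T, ContDiffAt ℝ 2 (fun p : EuclideanSpace ℝ (Fin 3) =>
        (((p 0 ^ 2 + p 1 ^ 2 + p 2 ^ 2 + 1) ^ (-(1 / 2) : ℝ) : ℝ) : ℂ)
          * w₁ (coord a 0 p) * w₂ (coord a 1 p) * w₃ (coord a 2 p)) q := by
    intro q hq
    have hw : ∀ (i : Fin 3) (w : ℝ → ℂ),
        IsFuchsSolution a l₁ l₂ (Set.Ioo (a i.castSucc) (a i.succ)) w →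
        ContDiffAt ℝ 2 (fun p => w (coord a i p)) q := fun i w h =>
      (h.contDiffAt isOpen_Ioo (fun s hs => sub_ne_zero_of_mem_Ioo ha hs)
        (coord_spec a ha i q hq).1).comp q (contDiffAt_coord ha i hq)
    exact (((Complex.ofRealCLM.contDiff.contDiffAt.comp q (contDiffAt_radial q)).mul
      (hw 0 w₁ hw₁)).mul (hw 1 w₂ hw₂)).mul (hw 2 w₃ hw₃)
  open FiveCyclide in
  have hΔ : ∀ q ∈ T, Laplacian.laplacian (fun p : EuclideanSpace ℝ (Fin 3) =>
        (((p 0 ^ 2 + p 1 ^ 2 + p 2 ^ 2 + 1) ^ (-(1 / 2) : ℝ) : ℝ) : ℂ)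
          * w₁ (coord a 0 p) * w₂ (coord a 1 p) * w₃ (coord a 2 p)) q = 0 := by
    intro q hq
    have hq0 : ∀ v : EuclideanSpace ℝ (Fin 3), q + (0 : ℝ) • v = q := by simp
    rw [InnerProductSpace.laplacian_eq_iteratedFDeriv_orthonormalBasis _
      (EuclideanSpace.basisFun (Fin 3) ℝ)]
    obtain ⟨b₁, c₁, hj₁, ho₁⟩ := hw₁.exists_hasTwoJetAt isOpen_Ioo (coord_spec a ha 0 q hq).1
    obtain ⟨b₂, c₂, hj₂, ho₂⟩ := hw₂.exists_hasTwoJetAt isOpen_Ioo (coord_spec a ha 1 q hq).1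
    obtain ⟨b₃, c₃, hj₃, ho₃⟩ := hw₃.exists_hasTwoJetAt isOpen_Ioo (coord_spec a ha 2 q hq).1
    obtain ⟨R, hR⟩ : ∃ R, R = q 0 ^ 2 + q 1 ^ 2 + q 2 ^ 2 + 1 := ⟨_, rfl⟩
    obtain ⟨ρ, hρ⟩ : ∃ ρ, ρ = R ^ (-(1 / 2) : ℝ) := ⟨_, rfl⟩
    have hR0 : R ≠ 0 := by rw [hR]; positivity
    -- The k-th unmixed second partial derivative of u, expanded by the product rule along the k-th
    -- coordinate line.
    have hk := fun k =>
      (hasTwoJetAt_line_of_contDiffAt (hu q hq) (stdVec k)).deriv_deriv_eq.symm.trans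
        (HasTwoJetAt.ofReal_mul_comp₃ (hasTwoJetAt_radial_line q k hR hρ)
          (hasTwoJetAt_coord_line ha hq 0 k) (hasTwoJetAt_coord_line ha hq 1 k)
          (hasTwoJetAt_coord_line ha hq 2 k) (by simpa only [hq0] using hj₁)
          (by simpa only [hq0] using hj₂) (by simpa only [hq0] using hj₃))
    simp only [hq0, ← hR, ← hρ] at hk
    have n := fun i => sub_ne_zero_of_mem_Ioo ha (coord_spec a ha i q hq).1
    have z := fun i => (coord_spec a ha i q hq).2
    have s₁₂ := (coord_lt_coord ha hq (show (0 : Fin 3) < 1 by decide)).ne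
    have s₁₃ := (coord_lt_coord ha hq (show (0 : Fin 3) < 2 by decide)).ne
    have s₂₃ := (coord_lt_coord ha hq (show (1 : Fin 3) < 2 by decide)).ne
    have H₁ := negSlope_mul_prod s₁₂ s₁₃ s₂₃ (n 0) (n 1) (n 2) (z 0) (z 1) (z 2)
    have H₂ := negSlope_mul_prod s₁₂.symm s₂₃ s₁₃ (n 1) (n 0) (n 2) (z 1) (z 0) (z 2)
    have H₃ := negSlope_mul_prod s₁₃.symm s₂₃.symm s₁₂ (n 2) (n 0) (n 1) (z 2) (z 0) (z 1)
    rw [← hR] at H₁ H₂ H₃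
    apply_fun ((↑) : ℝ → ℂ) at H₁ H₂ H₃
    push_cast at H₁ H₂ H₃
    -- Leading coefficient 3/16 makes the sum of potentials equal to -3/R².
    have hL := lagrange_identity (by exact_mod_cast s₁₂) (by exact_mod_cast s₁₃)
      (by exact_mod_cast s₂₃) (by exact_mod_cast hR0) H₁ H₂ H₃ (3 / 16) l₁ l₂
    have A := fun i => congrArg ((↑) : ℝ → ℂ) (sum_coordDeriv_sq ha hq i)
    have B₁₂ := congrArg ((↑) : ℝ → ℂ)
      (sum_coordDeriv_mul ha hq (show (0 : Fin 3) < 1 by decide))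
    have B₁₃ := congrArg ((↑) : ℝ → ℂ)
      (sum_coordDeriv_mul ha hq (show (0 : Fin 3) < 2 by decide))
    have B₂₃ := congrArg ((↑) : ℝ → ℂ)
      (sum_coordDeriv_mul ha hq (show (1 : Fin 3) < 2 by decide))
    have C := fun i => congrArg ((↑) : ℝ → ℂ) (sum_coordDeriv₂ ha hq i)
    simp only [← hR] at C
    push_cast at A B₁₂ B₁₃ B₂₃ C
    -- Division of the Fuchsian equation by P.
    have E : ∀ {P b c S V w : ℂ}, P ≠ 0 → P * (c + 1 / 2 * S * b) + V * w = 0 →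
        c + 1 / 2 * S * b + V / P * w = 0 := by
      intro P b c S V w hP h
      field_simp at h ⊢
      linear_combination h
    have E₁ := E (prod_sub_ne_zero (n 0)) ho₁
    have E₂ := E (prod_sub_ne_zero (n 1)) ho₂
    have E₃ := E (prod_sub_ne_zero (n 2)) ho₃
    -- This is Δρ = -3ρ/R², from |q|² = R - 1.
    have D : ((3 * q 0 ^ 2 * ρ / R ^ 2 - ρ / R : ℝ) : ℂ) + ((3 * q 1 ^ 2 * ρ / R ^ 2 - ρ / R : ℝ) : ℂ)
        + ((3 * q 2 ^ 2 * ρ / R ^ 2 - ρ / R : ℝ) : ℂ) = -(3 / R ^ 2) * ρ := by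
      have : 3 * q 0 ^ 2 * ρ / R ^ 2 - ρ / R + (3 * q 1 ^ 2 * ρ / R ^ 2 - ρ / R)
          + (3 * q 2 ^ 2 * ρ / R ^ 2 - ρ / R) = -(3 / R ^ 2) * ρ := by
        field_simp
        linear_combination -3 * ρ * hR
      exact_mod_cast this
    beta_reduce
    rw [Fin.sum_univ_three]
    change iteratedFDeriv ℝ 2 _ q ![stdVec 0, stdVec 0] + iteratedFDeriv ℝ 2 _ q
      ![stdVec 1, stdVec 1] + iteratedFDeriv ℝ 2 _ q ![stdVec 2, stdVec 2] = 0
    rw [hk 0, hk 1, hk 2]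
    generalize w₁ (coord a 0 q) = W₁ at *
    generalize w₂ (coord a 1 q) = W₂ at *
    generalize w₃ (coord a 2 q) = W₃ at *
    push_cast at D ⊢
    -- `A` replaces |∇sᵢ|² next to wᵢ'', `C` replaces Δsᵢ next to wᵢ', and the `B` identities remove
    -- the mixed products wᵢ'wⱼ'. Then `E₁`, `E₂`, `E₃` trade derivatives for potentials, whose sum
    -- `hL` cancels against `D`.
    linear_combination (W₁ * W₂ * W₃) * D
      + ρ * c₁ * W₂ * W₃ * A 0 + ρ * c₂ * W₁ * W₃ * A 1 + ρ * c₃ * W₁ * W₂ * A 2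
      + ρ * b₁ * W₂ * W₃ * C 0 + ρ * b₂ * W₁ * W₃ * C 1 + ρ * b₃ * W₁ * W₂ * C 2
      + 2 * ρ * b₁ * b₂ * W₃ * B₁₂ + 2 * ρ * b₁ * b₃ * W₂ * B₁₃ + 2 * ρ * b₂ * b₃ * W₁ * B₂₃
      + ρ * (16 / negSlope a q (coord a 0 q)) * W₂ * W₃ * E₁
      + ρ * (16 / negSlope a q (coord a 1 q)) * W₁ * W₃ * E₂
      + ρ * (16 / negSlope a q (coord a 2 q)) * W₁ * W₂ * E₃
      - ρ * W₁ * W₂ * W₃ * hL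
  -- Harmonicity at q requires the Laplacian to vanish on a neighbourhood of q, which T provides
  -- since it is open.
  exact fun q hq => ⟨hu q hq, Filter.eventually_of_mem (FiveCyclide.isOpen_T.mem_nhds hq) hΔ⟩
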